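/- For a finite bitstring $\sigma$ let $[\sigma]\subseteq\{0,1\}^{\mathbb N}$ be the set of infinite bitstrings extending $\sigma$, and let $\mu$ be Lebesgue (fair-coin) measure on $\{0,1\}^{\mathbb N}$. A real $r$ is computable if there is a computable $f:\mathbb N\to\mathbb Q$ with $|f(n)-r|<2^{-n}$ for all $n$. A Schnorr test is a computable sequence $(S^m)_{m\in\mathbb N}$ of finite sets of finite bitstrings such that, with $[S^m]=\bigcup_{\sigma\in S^m}[\sigma]$, the sum $\sum_m\mu([S^m])$ is finite and a computable real. An infinite bitstring $X$ fails the test if $X\in[S^m]$ for infinitely many $m$, and $X$ is Schnorr random if it fails no Schnorr test. A computable measure machine is a partial computable function $C$ from finite bitstrings to finite bitstrings whose domain is prefix-free and for which $\mu\bigl(\bigcup_{\tau\in\mathrm{dom}(C)}[\tau]\bigr)$ is a computable real. Put $K_C(\sigma)=\inf\{|\tau|: C(\tau)=\sigma\}$, with $\inf\emptyset=\infty$, and let $X\upharpoonright n$ be the initial segment of $X$ of length $n$. Theorem. An infinite bitstring $X$ is Schnorr random if and only if for every computable measure machine $C$ and every $d\in\mathbb N$, $K_C(X\upharpoonright n)>n+d$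 holds for all but finitely many $n$. -/

import Mathlib

namespace SchnorrK

/-- The initial segment of length `n` of the infinite bitstring `X`. -/
def initSeg (X : ℕ → Bool) (n : ℕ) : List Bool :=
  List.ofFn fun i : Fin n => X i

/-- The infinite bitstrings that extend the finite bitstring `σ`. -/
def cyl (σ : List Bool) : Set (ℕ → Bool) :=
  {X | initSeg X σ.length = σ}

/-- The subset of Cantor space generated by a set `A` of finite bitstrings. -/
def generated (A : Set (List Bool)) : Set (ℕ → Bool) :=
  ⋃ σ ∈ A, cyl σ

/-- Lebesgue (fair coin) measure on Cantor space. -/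
noncomputable def lebesgue : MeasureTheory.Measure (ℕ → Bool) :=
  MeasureTheory.Measure.infinitePi fun _ : ℕ => (PMF.uniformOfFintype Bool).toMeasure

/-- A computable sequence of rationals: a rational is given by three natural numbers `a, b, c`
as `(a - b) / (c + 1)`. -/
def ComputableRatSeq (f : ℕ → ℚ) : Prop :=
  ∃ a b c : ℕ → ℕ, Computable a ∧ Computable b ∧ Computable c ∧
    ∀ n, f n = ((a n : ℚ) - (b n : ℚ)) / ((c n : ℚ) + 1)

/-- A real number that some computable sequence of rationals approximates with error `< 2⁻ⁿ`. -/
def ComputableReal (r : ℝ) : Prop :=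
  ∃ f : ℕ → ℚ, ComputableRatSeq f ∧ ∀ n : ℕ, |(f n : ℝ) - r| < (1 / 2 : ℝ) ^ n

/-- A Schnorr test: a computable sequence of finite collections of strings for which the sum of
the measures of the generated sets is finite and a computable real number. -/
def IsSchnorrTest (S : ℕ → List (List Bool)) : Prop :=
  Computable S ∧
    ∃ r : ℝ, ComputableReal r ∧ HasSum (fun m => lebesgue.real (generated {σ | σ ∈ S m})) r

/-- `X` fails the test if it lies in infinitely many of the sets generated by its components. -/
def Fails (X : ℕ → Bool) (S : ℕ → List (List Bool)) : Prop :=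
  ∃ᶠ m in Filter.atTop, X ∈ generated {σ | σ ∈ S m}

/-- `X` is Schnorr random if it passes (does not fail) every Schnorr test. -/
def SchnorrRandom (X : ℕ → Bool) : Prop :=
  ∀ S : ℕ → List (List Bool), IsSchnorrTest S → ¬ Fails X S

/-- No string in `A` is a proper prefix of another string in `A`. -/
def PrefixFree (A : Set (List Bool)) : Prop :=
  ∀ σ ∈ A, ∀ τ ∈ A, σ <+: τ → σ = τ

/-- A computable measure machine: a partial computable function on strings with prefix-free
domain, such that the Lebesgue measure of the set generated by the domain is a computable real. -/
def IsComputableMeasureMachine (C : List Bool →. List Bool) : Prop :=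
  Partrec C ∧ PrefixFree C.Dom ∧ ComputableReal (lebesgue.real (generated C.Dom))

/-- `K_C(σ)`, the least length of a `τ` with `C(τ) = σ`, and `⊤` if there is no such `τ`. -/
noncomputable def K (C : List Bool →. List Bool) (σ : List Bool) : ℕ∞ :=
  ⨅ (τ : List Bool) (_ : σ ∈ C τ), (τ.length : ℕ∞)

end SchnorrK

/-!
Both directions convert between tests and machines, and no form of the Kraft-Chaitin theorem is
needed.

*From machines to tests* (`IsComputableMeasureMachine.exists_isSchnorrTest`). The graph of a
computable measure machine `C` is enumerated computably and without repetitions as pairs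
`(τ, σ)`; the pairs with `|τ| ≤ |σ| + d` contribute the component `{σ}`. Since
`μ[σ] ≤ 2 ^ d * μ[τ]` and the sum of all `μ[τ]` is the measure of the domain of `C`, which is
computable, the sum of the `μ[σ]` converges computably as well. If `K_C(X ↾ n) ≤ n + d` for
infinitely many `n`, the corresponding pairs are distinct, so `X` fails this test.

*From tests to machines* (`IsSchnorrTest.exists_machine`). As the sum of the measures of a test
`S` is computable, so is a sequence `M` such that the components from `M k` on have total measure
less than `4⁻ᵏ`. The components `S m` with `M k ≤ m < M (k + 1)` are replaced by the list `T k` of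
all strings of one common length `ℓ k + 2 * k` that extend one of their elements. Then `T k`
has at most `2 ^ ℓ k` entries, so its entries can be described by the codewords `1ᵏ 0 w` with
`|w| = ℓ k`, whose length `k + 1 + ℓ k` does not exceed that of the entries when `k ≥ 1`. Admitting
all these codewords, whether used or not, makes the domain prefix-free and of measure exactly `1`,
because they generate every infinite bitstring other than `111…`.

The computability of the sums rests on `exists_computable_modulus`: a series of dyadic rationals
with a computable sum has a computable modulus of convergence, and any series dominated by a
multiple of it inherits that modulus (`exists_computableReal_hasSum_of_le`).
-/

namespace SchnorrK

open MeasureTheory Filter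

/-! ### The measure of cylinders -/

theorem length_initSeg (X : ℕ → Bool) (n : ℕ) : (initSeg X n).length = n := by
  simp [initSeg]

theorem mem_cyl {X : ℕ → Bool} {σ : List Bool} :
    X ∈ cyl σ ↔ ∀ i (h : i < σ.length), X i = σ[i] := by
  simp only [cyl, Set.mem_ofPred_eq]
  refine ⟨fun h i hi => ?_, fun h => ?_⟩
  · have h1 : i < (initSeg X σ.length).length := by rw [length_initSeg]; exact hi
    have h2 : (initSeg X σ.length)[i] = X i := by simp [initSeg]
    rw [← h2]
    congr 1
  · refine List.ext_getElem (length_initSeg _ _) fun i h1 h2 => ?_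
    simp [initSeg, h i h2]

theorem mem_generated {X : ℕ → Bool} {A : Set (List Bool)} :
    X ∈ generated A ↔ ∃ σ ∈ A, X ∈ cyl σ := by
  simp [generated]

theorem mem_cyl_initSeg (X : ℕ → Bool) (n : ℕ) : X ∈ cyl (initSeg X n) := by
  simp [cyl, length_initSeg]

theorem prefix_initSeg {X : ℕ → Bool} {σ : List Bool} {n : ℕ} (h : σ.length ≤ n) :
    σ <+: initSeg X n ↔ X ∈ cyl σ := by
  rw [List.prefix_iff_getElem, mem_cyl]
  simp only [length_initSeg, h, exists_true_left]
  simp [initSeg, eq_comm]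

theorem prefix_or_prefix_of_mem_cyl {X : ℕ → Bool} {σ τ : List Bool} (hσ : X ∈ cyl σ)
    (hτ : X ∈ cyl τ) : σ <+: τ ∨ τ <+: σ := by
  rw [← prefix_initSeg (le_max_left σ.length τ.length)] at hσ
  rw [← prefix_initSeg (le_max_right σ.length τ.length)] at hτ
  exact List.prefix_or_prefix_of_prefix hσ hτ

theorem cyl_eq_pi (σ : List Bool) :
    cyl σ = Set.pi (Finset.range σ.length) fun i => {σ.getD i false} := by
  ext X
  simp only [mem_cyl, Set.mem_pi, Finset.coe_range, Set.mem_Iio, Set.mem_singleton_iff]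
  refine forall₂_congr fun i hi => ?_
  rw [List.getD_eq_getElem _ _ hi]

theorem measurableSet_cyl (σ : List Bool) : MeasurableSet (cyl σ) := by
  rw [cyl_eq_pi]
  exact MeasurableSet.pi (Finset.countable_toSet _) fun _ _ => MeasurableSet.singleton _

theorem measurableSet_generated (A : Set (List Bool)) : MeasurableSet (generated A) :=
  MeasurableSet.biUnion A.to_countable fun σ _ => measurableSet_cyl σ

instance : IsProbabilityMeasure lebesgue := by
  unfold lebesgue
  infer_instance

theorem lebesgue_real_cyl (σ : List Bool) : lebesgue.real (cyl σ) = 1 / 2 ^ σ.length := by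
  have h : lebesgue (cyl σ) = (1 / 2) ^ σ.length := by
    rw [cyl_eq_pi, lebesgue, Measure.infinitePi_pi _ fun _ _ => MeasurableSet.singleton _]
    simp
  simp [Measure.real, h]

theorem disjoint_cyl {σ τ : List Bool} (h₁ : ¬ σ <+: τ) (h₂ : ¬ τ <+: σ) :
    Disjoint (cyl σ) (cyl τ) :=
  Set.disjoint_left.2 fun _ hσ hτ => (prefix_or_prefix_of_mem_cyl hσ hτ).elim h₁ h₂

theorem generated_singleton (σ : List Bool) : generated {τ | τ ∈ [σ]} = cyl σ := by
  simp [generated]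

/-- All bitstrings of length `n`. -/
def strings (n : ℕ) : List (List Bool) :=
  n.rec [[]] fun _ l => l.map (List.cons false) ++ l.map (List.cons true)

theorem mem_strings {n : ℕ} {w : List Bool} : w ∈ strings n ↔ w.length = n := by
  induction n generalizing w with
  | zero => simp [strings]
  | succ n ih =>
    change w ∈ (strings n).map _ ++ (strings n).map _ ↔ _
    rcases w with _ | ⟨_ | _, w⟩ <;> simp [ih]

theorem length_strings (n : ℕ) : (strings n).length = 2 ^ n := by
  induction n with
  | zero => simp [strings]
  | succ n ih =>
    change ((strings n).map _ ++ (strings n).map _).length = _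
    simp [ih, pow_succ, mul_two]

theorem nodup_strings (n : ℕ) : (strings n).Nodup := by
  induction n with
  | zero => simp [strings]
  | succ n ih =>
    change ((strings n).map _ ++ (strings n).map _).Nodup
    refine List.Nodup.append (ih.map (List.cons_injective)) (ih.map (List.cons_injective)) ?_
    intro w h1 h2
    simp only [List.mem_map] at h1 h2
    obtain ⟨_, _, rfl⟩ := h1
    obtain ⟨_, _, h⟩ := h2
    simp at h

/-- The strings of length `n` that extend an element of `S`. The prefix relation is spelled with
`List.take`, which is primitive recursive. -/
def extensions (S : List (List Bool)) (n : ℕ) : List (List Bool) :=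
  (strings n).filter fun w => ∃ σ ∈ S, w.take σ.length = σ

theorem mem_extensions {S : List (List Bool)} {n : ℕ} {w : List Bool} :
    w ∈ extensions S n ↔ w.length = n ∧ ∃ σ ∈ S, σ <+: w := by
  simp [extensions, mem_strings, List.prefix_iff_eq_take, eq_comm]

theorem initSeg_mem_extensions {S : List (List Bool)} {n : ℕ} (h : ∀ σ ∈ S, σ.length ≤ n)
    {X : ℕ → Bool} : initSeg X n ∈ extensions S n ↔ X ∈ generated {σ | σ ∈ S} := by
  simp only [mem_extensions, length_initSeg, true_and, mem_generated, Set.mem_ofPred_eq]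
  exact exists_congr fun σ => and_congr_right fun hσ => prefix_initSeg (h σ hσ)

theorem lebesgue_real_generated {S : List (List Bool)} {n : ℕ} (h : ∀ σ ∈ S, σ.length ≤ n) :
    lebesgue.real (generated {σ | σ ∈ S}) = (extensions S n).length / 2 ^ n := by
  have h1 : generated {σ | σ ∈ S} = ⋃ w ∈ (extensions S n).toFinset, cyl w := by
    ext X
    rw [← initSeg_mem_extensions h]
    simp only [List.mem_toFinset, Set.mem_iUnion, exists_prop]
    refine ⟨fun hX => ⟨_, hX, mem_cyl_initSeg X n⟩, ?_⟩
    rintro ⟨w, hw, hX⟩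
    have : initSeg X w.length = w := hX
    rw [(mem_extensions.1 hw).1] at this
    rwa [this]
  have h2 : ∀ w ∈ (extensions S n).toFinset, lebesgue.real (cyl w) = 1 / 2 ^ n := by
    intro w hw
    rw [lebesgue_real_cyl, (mem_extensions.1 (List.mem_toFinset.1 hw)).1]
  have hn : (extensions S n).Nodup := (nodup_strings n).filter _
  rw [h1, measureReal_biUnion_finset _ fun w _ => measurableSet_cyl w, Finset.sum_congr rfl h2,
    Finset.sum_const, List.toFinset_card_of_nodup hn]
  · simp [div_eq_mul_inv]
  · intro σ hσ τ hτ hne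
    have hl : σ.length = τ.length := by
      rw [(mem_extensions.1 (List.mem_toFinset.1 hσ)).1,
        (mem_extensions.1 (List.mem_toFinset.1 hτ)).1]
    exact disjoint_cyl (fun h => hne (h.eq_of_length hl))
      fun h => hne (h.eq_of_length hl.symm).symm

theorem length_le_length_flatten {S : List (List Bool)} {σ : List Bool} (h : σ ∈ S) :
    σ.length ≤ S.flatten.length := by
  rw [List.length_flatten]
  exact List.single_le_sum (by simp) _ (List.mem_map_of_mem h)

/-! ### Computability -/

theorem primrec_two_pow : Primrec fun n : ℕ => 2 ^ n :=
  (Primrec.nat_rec₁ 1 (Primrec.nat_mul.comp Primrec.snd (Primrec.const 2)).to₂).of_eq fun n => by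
    induction n with
    | zero => rfl
    | succ n ih => simp_all [pow_succ]

theorem primrec_strings : Primrec strings :=
  Primrec.nat_rec₁ [[]] <| (Primrec.list_append.comp
    (Primrec.list_map Primrec.snd (Primrec.list_cons.comp (Primrec.const false) Primrec.snd).to₂)
    (Primrec.list_map Primrec.snd
      (Primrec.list_cons.comp (Primrec.const true) Primrec.snd).to₂)).to₂

theorem primrec_extensions : Primrec₂ extensions := by
  have h1 : PrimrecRel fun (σ w : List Bool) => w.take σ.length = σ :=
    Primrec.eq.comp
      (Primrec.list_take.comp (Primrec.list_length.comp Primrec.fst) Primrec.snd) Primrec.fst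
  have h2 : PrimrecRel fun (w : List Bool) (S : List (List Bool)) =>
      ∃ σ ∈ S, w.take σ.length = σ := (h1.exists_mem_list).swap
  exact h2.listFilter.comp (primrec_strings.comp Primrec.snd) Primrec.fst

theorem computable_find {P : ℕ → ℕ → Prop}
    (hP : ComputablePred fun p : ℕ × ℕ => P p.1 p.2) (h : ∀ n, ∃ m, P n m) :
    ∃ f : ℕ → ℕ, Computable f ∧ ∀ n, P n (f n) := by
  classical
  exact ⟨_, Computable.find hP h, fun n => Nat.find_spec (h n)⟩

/-- A computable sequence of dyadic rationals, given by numerators and binary exponents of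
denominators. -/
def ComputableDyadicSeq (w : ℕ → ℝ) : Prop :=
  ∃ num e : ℕ → ℕ, Computable num ∧ Computable e ∧ ∀ m, w m = num m / 2 ^ e m

theorem ComputableDyadicSeq.nonneg {w : ℕ → ℝ} (h : ComputableDyadicSeq w) (m : ℕ) :
    0 ≤ w m := by
  obtain ⟨num, e, -, -, h⟩ := h
  rw [h]
  positivity

theorem ComputableDyadicSeq.sum_range {w : ℕ → ℝ} (h : ComputableDyadicSeq w) :
    ComputableDyadicSeq fun n => ∑ m ∈ Finset.range n, w m := by
  obtain ⟨num, e, hnum, he, h⟩ := h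
  -- addition of fractions without cancelling, on pairs (numerator, exponent of the denominator)
  let step : ℕ → ℕ × ℕ → ℕ × ℕ := fun m p => (p.1 * 2 ^ e m + num m * 2 ^ p.2, p.2 + e m)
  let F : ℕ → ℕ × ℕ := fun n => n.rec (0, 0) step
  have hF : Computable F := by
    have pw : Computable fun n : ℕ => 2 ^ n := primrec_two_pow.to_comp
    have mul : Computable₂ fun a b : ℕ => a * b := Primrec.nat_mul.to_comp
    have add : Computable₂ fun a b : ℕ => a + b := Primrec.nat_add.to_comp
    have m : Computable fun q : ℕ × ℕ × (ℕ × ℕ) => q.2.1 := Computable.fst.comp Computable.snd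
    have p : Computable fun q : ℕ × ℕ × (ℕ × ℕ) => q.2.2 := Computable.snd.comp Computable.snd
    have p1 := Computable.fst.comp p
    have p2 := Computable.snd.comp p
    exact Computable.nat_rec Computable.id (Computable.const (0, 0))
      (Computable.pair
        (add.comp (mul.comp p1 (pw.comp (he.comp m))) (mul.comp (hnum.comp m) (pw.comp p2)))
        (add.comp p2 (he.comp m))).to₂
  refine ⟨fun n => (F n).1, fun n => (F n).2, Computable.fst.comp hF, Computable.snd.comp hF,
    fun n => ?_⟩
  induction n with
  | zero => simp [F]
  | succ n ih =>
    have : F (n + 1) = step n (F n) := rfl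
    beta_reduce at ih ⊢
    rw [Finset.sum_range_succ, ih, h, this]
    simp only [step]
    push_cast
    rw [pow_add]
    field_simp

/-- A series of non-negative terms with a computable sum has a computable modulus of convergence:
a sufficiently long partial sum exceeds a rational slightly below the sum, and this can be
recognized. -/
theorem exists_computable_modulus {w : ℕ → ℝ} (hw : ComputableDyadicSeq w) {r : ℝ}
    (hr : ComputableReal r) (hs : HasSum w r) :
    ∃ N : ℕ → ℕ, Computable N ∧
      ∀ j, j ≤ N j ∧ r - ∑ m ∈ Finset.range (N j), w m < (1 / 2) ^ j := by
  obtain ⟨f, ⟨a, b, c, ha, hb, hc, hf⟩, hfr⟩ := hr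
  obtain ⟨P, E, hP, hE, hp⟩ := hw.sum_range
  beta_reduce at hp
  -- `f (j + 1) - 2⁻⁽ʲ⁺¹⁾ < ∑ m < n, w m`, with denominators cleared and subtractions moved across
  let R : ℕ → ℕ → Prop := fun j n => j ≤ n ∧
    a (j + 1) * 2 ^ (E n + (j + 1)) <
      (c (j + 1) + 1) * (P n * 2 ^ (j + 1) + 2 ^ E n) + b (j + 1) * 2 ^ (E n + (j + 1))
  have hR : ComputablePred fun p : ℕ × ℕ => R p.1 p.2 := by
    have lt : PrimrecPred fun p : (ℕ × ℕ) × ℕ × ℕ => p.1.1 ≤ p.1.2 ∧ p.2.1 < p.2.2 :=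
      (Primrec.nat_le.comp (Primrec.fst.comp Primrec.fst) (Primrec.snd.comp Primrec.fst)).and
        (Primrec.nat_lt.comp (Primrec.fst.comp Primrec.snd) (Primrec.snd.comp Primrec.snd))
    have pw : Computable fun n : ℕ => 2 ^ n := primrec_two_pow.to_comp
    have mul : Computable₂ fun a b : ℕ => a * b := Primrec.nat_mul.to_comp
    have add : Computable₂ fun a b : ℕ => a + b := Primrec.nat_add.to_comp
    have j1 : Computable fun p : ℕ × ℕ => p.1 + 1 := Computable.succ.comp Computable.fst
    have En : Computable fun p : ℕ × ℕ => E p.2 := hE.comp Computable.snd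
    have Pn : Computable fun p : ℕ × ℕ => P p.2 := hP.comp Computable.snd
    have q := pw.comp (add.comp En j1)
    refine Computable.computablePred ((lt.decide.to_comp.comp (Computable.id.pair (Computable.pair
      (mul.comp (ha.comp j1) q)
      (add.comp (mul.comp (Computable.succ.comp (hc.comp j1))
        (add.comp (mul.comp Pn (pw.comp j1)) (pw.comp En))) (mul.comp (hb.comp j1) q))))))
  have key : ∀ j n, R j n ↔
      j ≤ n ∧ (f (j + 1) : ℝ) - (1 / 2) ^ (j + 1) < ∑ m ∈ Finset.range n, w m := by
    intro j n
    refine and_congr_right fun _ => ?_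
    rw [hp, hf]
    push_cast
    rw [one_div_pow, ← Nat.cast_lt (α := ℝ)]
    push_cast
    have e1 : ((a (j + 1) : ℝ) - b (j + 1)) / (c (j + 1) + 1) - 1 / 2 ^ (j + 1) =
        (a (j + 1) * 2 ^ (E n + (j + 1)) - b (j + 1) * 2 ^ (E n + (j + 1)) -
          (c (j + 1) + 1) * 2 ^ E n) / ((c (j + 1) + 1) * 2 ^ (E n + (j + 1))) := by
      rw [pow_add]
      field_simp
      ring
    have e2 : (P n : ℝ) / 2 ^ E n = (c (j + 1) + 1) * (P n * 2 ^ (j + 1)) /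
        ((c (j + 1) + 1) * 2 ^ (E n + (j + 1))) := by
      rw [pow_add]
      field_simp
      ring
    rw [e1, e2, div_lt_div_iff_of_pos_right (by positivity)]
    constructor <;> intro h <;> linarith
  obtain ⟨N, hN, hRN⟩ := computable_find hR fun j => by
    have h1 := (abs_lt.1 (hfr (j + 1))).2
    have h2 : ∀ᶠ n in atTop, (f (j + 1) : ℝ) - (1 / 2) ^ (j + 1) < ∑ m ∈ Finset.range n, w m :=
      hs.tendsto_sum_nat.eventually_const_lt (by linarith)
    obtain ⟨n, hn, hn'⟩ := (h2.and (eventually_ge_atTop j)).exists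
    exact ⟨n, (key j n).2 ⟨hn', hn⟩⟩
  refine ⟨N, hN, fun j => ?_⟩
  obtain ⟨h1, h2⟩ := (key _ _).1 (hRN j)
  have h3 := (abs_lt.1 (hfr (j + 1))).1
  refine ⟨h1, ?_⟩
  have : (1 / 2 : ℝ) ^ j = 2 * (1 / 2) ^ (j + 1) := by rw [pow_succ]; ring
  linarith

theorem computableReal_of_modulus {w : ℕ → ℝ} (hw : ComputableDyadicSeq w) {r : ℝ}
    (hs : HasSum w r) {N : ℕ → ℕ} (hN : Computable N)
    (h : ∀ j, r - ∑ m ∈ Finset.range (N j), w m < (1 / 2) ^ j) : ComputableReal r := by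
  obtain ⟨P, E, hP, hE, hp⟩ := hw.sum_range
  beta_reduce at hp
  refine ⟨fun j => P (N j) / 2 ^ E (N j), ⟨fun j => P (N j), fun _ => 0,
    fun j => 2 ^ E (N j) - 1, hP.comp hN, Computable.const 0,
    Computable.pred.comp (primrec_two_pow.to_comp.comp (hE.comp hN)), fun j => ?_⟩, fun j => ?_⟩
  · simp
  · push_cast
    rw [← hp, abs_sub_comm, abs_of_nonneg]
    · exact h j
    · exact sub_nonneg.2 (sum_le_hasSum _ (fun m _ => hw.nonneg m) hs)

/-- A series dominated by a constant multiple of a computable series with computable sum inherits a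
computable modulus of convergence, so its sum is computable too. -/
theorem exists_computableReal_hasSum_of_le {w q : ℕ → ℝ} (hw : ComputableDyadicSeq w)
    (hq : ComputableDyadicSeq q) {d : ℕ} (h : ∀ m, w m ≤ 2 ^ d * q m) {r : ℝ}
    (hr : ComputableReal r) (hs : HasSum q r) : ∃ s, ComputableReal s ∧ HasSum w s := by
  have hs' := hs.mul_left ((2 : ℝ) ^ d)
  have hws : HasSum w (∑' m, w m) := (hs'.summable.of_nonneg_of_le hw.nonneg h).hasSum
  obtain ⟨N, hN, hNr⟩ := exists_computable_modulus hq hr hs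
  refine ⟨_, computableReal_of_modulus hw hws (N := fun j => N (j + d))
    (hN.comp (Primrec.nat_add.to_comp.comp Computable.id (Computable.const d))) fun j => ?_, hws⟩
  have h1 := sum_le_hasSum (Finset.range (N (j + d))) (fun m _ => sub_nonneg.2 (h m))
    (hs'.sub hws)
  rw [Finset.sum_sub_distrib, ← Finset.mul_sum] at h1
  have h2 := mul_lt_mul_of_pos_left (hNr (j + d)).2 (show (0 : ℝ) < 2 ^ d by positivity)
  have h3 : (2 : ℝ) ^ d * (1 / 2) ^ (j + d) = (1 / 2) ^ j := by
    rw [pow_add, one_div_pow, one_div_pow]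
    field_simp
  linarith

theorem computableDyadicSeq_generated {S : ℕ → List (List Bool)} (hS : Computable S) :
    ComputableDyadicSeq fun m => lebesgue.real (generated {σ | σ ∈ S m}) := by
  have he : Computable fun m => (S m).flatten.length :=
    Primrec.list_length.to_comp.comp (Primrec.list_flatten.to_comp.comp hS)
  exact ⟨_, _, Primrec.list_length.to_comp.comp (primrec_extensions.to_comp.comp hS he), he,
    fun m => lebesgue_real_generated fun σ => length_le_length_flatten⟩

theorem computableReal_one : ComputableReal 1 := by
  refine ⟨fun _ => 1, ⟨fun _ => 1, fun _ => 0, fun _ => 0, Computable.const _, Computable.const _,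
    Computable.const _, fun n => by simp⟩, fun n => by simp⟩

/-! ### From machines to tests -/

theorem K_le_natCast {C : List Bool →. List Bool} {σ : List Bool} {n : ℕ} :
    K C σ ≤ n ↔ ∃ τ, σ ∈ C τ ∧ τ.length ≤ n := by
  constructor
  · intro h
    by_contra! hc
    have h1 : ((n + 1 : ℕ) : ℕ∞) ≤ K C σ :=
      le_iInf₂ fun τ hτ => Nat.cast_le.2 (hc τ hτ)
    have h2 := Nat.cast_le.1 (h1.trans h)
    omega
  · rintro ⟨τ, hτ, hl⟩
    exact (iInf₂_le τ hτ).trans (Nat.cast_le.2 hl)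

open Nat.Partrec (Code) in
open Encodable in
/-- The graph of a partial computable function can be enumerated computably, each argument
occurring at most once: at stage `⟨s, encode a⟩`, list `a` if the computation on `a` terminates
within `s + 1` steps but not within `s` steps. -/
theorem exists_graph_enumeration {α β : Type*} [Primcodable α] [Primcodable β] {C : α →. β}
    (hC : Partrec C) :
    ∃ g : ℕ → Option (α × β), Computable g ∧ (∀ a b, b ∈ C a ↔ ∃ k, g k = some (a, b)) ∧
      ∀ k k' a b b', g k = some (a, b) → g k' = some (a, b') → k = k' := by
  obtain ⟨c, hc⟩ := Code.exists_code.1 hC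
  have hca : ∀ a, c.eval (encode a) = (C a).map encode := fun a => by
    rw [hc]
    simp
  -- `decode` need not be injective, so numbers other than `encode a` that decode to `a` are skipped
  let g : ℕ → Option (α × β) := fun n =>
    (decode (α := α) n.unpair.2).bind fun a =>
      if c.evaln n.unpair.1 n.unpair.2 = none ∧ encode a = n.unpair.2 then
        (c.evaln (n.unpair.1 + 1) n.unpair.2).bind fun y => (decode (α := β) y).map fun b => (a, b)
      else none
  have hg : ∀ k a b, g k = some (a, b) ↔ encode a = k.unpair.2 ∧
      c.evaln k.unpair.1 (encode a) = none ∧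
        ∃ y ∈ c.evaln (k.unpair.1 + 1) (encode a), decode (α := β) y = some b := by
    intro k a b
    simp only [g, Option.bind_eq_some_iff, Option.ite_none_right_eq_some, Option.map_eq_some_iff,
      Prod.mk.injEq, Option.mem_def]
    constructor
    · rintro ⟨a, h1, ⟨h2, h3⟩, y, h4, b, h5, rfl, rfl⟩
      rw [h3]
      exact ⟨rfl, h2, y, h4, h5⟩
    · rintro ⟨h1, h2, y, h3, h4⟩
      rw [← h1]
      exact ⟨a, encodek a, ⟨h2, rfl⟩, y, h3, b, h4, rfl, rfl⟩
  refine ⟨g, ?_, fun a b => ⟨fun h => ?_, ?_⟩, fun k k' a b b' h h' => ?_⟩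
  · have ev : Primrec fun p : ℕ × ℕ => c.evaln p.1 p.2 :=
      Code.primrec_evaln.comp
        ((Primrec.fst.pair (Primrec.const c)).pair Primrec.snd)
    have s : Primrec fun n : ℕ => n.unpair.1 := Primrec.fst.comp Primrec.unpair
    have x : Primrec fun n : ℕ => n.unpair.2 := Primrec.snd.comp Primrec.unpair
    have f : Primrec (Prod.fst : ℕ × α → ℕ) := Primrec.fst
    refine Primrec.to_comp (Primrec.option_bind (Primrec.decode.comp x) ?_)
    refine Primrec.ite
      ((Primrec.eq.comp (ev.comp ((s.comp f).pair (x.comp f))) (Primrec.const none)).and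
        (Primrec.eq.comp (Primrec.encode.comp Primrec.snd) (x.comp f)))
      (Primrec.option_bind (ev.comp ((Primrec.succ.comp (s.comp f)).pair (x.comp f))) ?_)
      (Primrec.const none)
    exact Primrec.option_map (Primrec.decode.comp Primrec.snd)
      ((Primrec.snd.comp (Primrec.fst.comp Primrec.fst)).pair Primrec.snd).to₂
  · have h1 : encode b ∈ c.eval (encode a) := by
      rw [hca]
      exact Part.mem_map _ h
    have h2 : ∃ s, encode b ∈ c.evaln s (encode a) := Code.evaln_complete.1 h1
    classical
    obtain ⟨s, hs⟩ : ∃ s, Nat.find h2 = s + 1 := by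
      refine Nat.exists_eq_succ_of_ne_zero fun h0 => ?_
      have := Nat.find_spec h2
      rw [h0] at this
      simp [Code.evaln] at this
    have h3 := Nat.find_spec h2
    rw [hs] at h3
    refine ⟨Nat.pair s (encode a), (hg _ _ _).2 ?_⟩
    simp only [Nat.unpair_pair, true_and]
    refine ⟨?_, _, h3, encodek b⟩
    rw [Option.eq_none_iff_forall_not_mem]
    intro y hy
    refine Nat.find_min h2 (m := s) (by omega) ?_
    rwa [Part.mem_unique h1 (Code.evaln_sound hy)]
  · rintro ⟨k, hk⟩
    obtain ⟨-, -, y, hy, hyb⟩ := (hg _ _ _).1 hk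
    have := Code.evaln_sound hy
    rw [hca, Part.mem_map_iff] at this
    obtain ⟨b', hb', rfl⟩ := this
    rw [encodek, Option.some_inj] at hyb
    rwa [← hyb]
  · obtain ⟨h1, h2, y, h3, -⟩ := (hg _ _ _).1 h
    obtain ⟨h1', h2', y', h3', -⟩ := (hg _ _ _).1 h'
    have key : ∀ s s', c.evaln s (encode a) = none → ∀ y ∈ c.evaln (s' + 1) (encode a),
        s ≤ s' := by
      intro s s' hs y hy
      by_contra! hlt
      have := Code.evaln_mono (Nat.succ_le_of_lt hlt) hy
      simp [hs] at this
    rw [← Nat.pair_unpair k, ← Nat.pair_unpair k', ← h1, ← h1',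
      le_antisymm (key _ _ h2 _ h3') (key _ _ h2' _ h3)]

/-- If `C` is a computable measure machine, the strings `C τ` with `|τ| ≤ |C τ| + d` form a Schnorr
test: the measure of `[C τ]` is at most `2 ^ d` times that of `[τ]`, and the sum of the latter is
the measure of the domain. -/
theorem IsComputableMeasureMachine.exists_isSchnorrTest {C : List Bool →. List Bool}
    (hC : IsComputableMeasureMachine C) (d : ℕ) :
    ∃ S, IsSchnorrTest S ∧ ∀ X : ℕ → Bool,
      (∃ᶠ n in atTop, K C (initSeg X n) ≤ (n + d : ℕ)) → Fails X S := by
  obtain ⟨hpart, hfree, hreal⟩ := hC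
  obtain ⟨g, hg, hgC, hginj⟩ := exists_graph_enumeration hpart
  let D : ℕ → List (List Bool) := fun k => ((g k).map fun p => [p.1]).getD []
  let S : ℕ → List (List Bool) := fun k =>
    ((g k).map fun p => if p.1.length ≤ p.2.length + d then [p.2] else []).getD []
  have hD : Computable D := by
    have : Primrec fun p : List Bool × List Bool => [p.1] :=
      Primrec.list_cons.comp Primrec.fst (Primrec.const [])
    exact Computable.option_getD
      (Computable.option_map hg (this.to_comp.comp Computable.snd).to₂) (Computable.const [])
  have hS : Computable S := by
    have : Primrec fun p : List Bool × List Bool =>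
        if p.1.length ≤ p.2.length + d then [p.2] else [] :=
      Primrec.ite (Primrec.nat_le.comp (Primrec.list_length.comp Primrec.fst)
        (Primrec.nat_add.comp (Primrec.list_length.comp Primrec.snd) (Primrec.const d)))
        (Primrec.list_cons.comp Primrec.snd (Primrec.const [])) (Primrec.const [])
    exact Computable.option_getD
      (Computable.option_map hg (this.to_comp.comp Computable.snd).to₂) (Computable.const [])
  have hDmem : ∀ k τ, τ ∈ D k ↔ ∃ σ, g k = some (τ, σ) := by
    intro k τ
    rcases h : g k with _ | ⟨τ', σ'⟩ <;> simp [D, h, eq_comm]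
  have hdom : generated C.Dom = ⋃ k, generated {τ | τ ∈ D k} := by
    ext X
    simp only [mem_generated, Set.mem_iUnion, Set.mem_ofPred_eq, hDmem, PFun.mem_dom, hgC]
    constructor
    · rintro ⟨τ, ⟨σ, k, h⟩, hX⟩
      exact ⟨k, τ, ⟨σ, h⟩, hX⟩
    · rintro ⟨k, τ, ⟨σ, h⟩, hX⟩
      exact ⟨τ, ⟨σ, k, h⟩, hX⟩
  have hdisj : Pairwise (Function.onFun Disjoint fun k => generated {τ | τ ∈ D k}) := by
    intro k k' hkk
    refine Set.disjoint_left.2 fun X hX hX' => hkk ?_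
    obtain ⟨τ, hτ, hX⟩ := mem_generated.1 hX
    obtain ⟨τ', hτ', hX'⟩ := mem_generated.1 hX'
    obtain ⟨σ, hσ⟩ := (hDmem _ _).1 hτ
    obtain ⟨σ', hσ'⟩ := (hDmem _ _).1 hτ'
    have h1 : τ ∈ C.Dom := (PFun.mem_dom _ _).2 ⟨σ, (hgC _ _).2 ⟨_, hσ⟩⟩
    have h1' : τ' ∈ C.Dom := (PFun.mem_dom _ _).2 ⟨σ', (hgC _ _).2 ⟨_, hσ'⟩⟩
    have h2 : τ = τ' := (prefix_or_prefix_of_mem_cyl hX hX').elim (hfree _ h1 _ h1')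
      fun h => (hfree _ h1' _ h1 h).symm
    subst h2
    exact hginj _ _ _ _ _ hσ hσ'
  have hsum : HasSum (fun k => lebesgue.real (generated {τ | τ ∈ D k}))
      (lebesgue.real (generated C.Dom)) := by
    have h1 := measure_iUnion (μ := lebesgue) hdisj fun k => measurableSet_generated _
    have h2 := measure_ne_top lebesgue (⋃ k, generated {τ | τ ∈ D k})
    rw [hdom, Measure.real, h1, ENNReal.tsum_toReal_eq fun k => measure_ne_top _ _]
    exact ENNReal.hasSum_toReal (h1 ▸ h2)
  have hle : ∀ k, lebesgue.real (generated {σ | σ ∈ S k}) ≤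
      2 ^ d * lebesgue.real (generated {τ | τ ∈ D k}) := by
    intro k
    rcases h : g k with _ | ⟨τ, σ⟩
    · simp [S, D, h, generated]
    · by_cases hl : τ.length ≤ σ.length + d
      · have h1 : S k = [σ] := by simp [S, h, hl]
        have h2 : D k = [τ] := by simp [D, h]
        rw [h1, h2, generated_singleton, generated_singleton, lebesgue_real_cyl,
          lebesgue_real_cyl, mul_one_div, div_le_div_iff₀ (by positivity) (by positivity), one_mul,
          ← pow_add, add_comm d]
        exact pow_le_pow_right₀ one_le_two hl
      · have h1 : S k = [] := by simp [S, h, hl]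
        rw [h1]
        simp only [generated, List.not_mem_nil]
        simp
  refine ⟨S, ⟨hS, exists_computableReal_hasSum_of_le (computableDyadicSeq_generated hS)
    (computableDyadicSeq_generated hD) hle hreal hsum⟩, fun X hX => ?_⟩
  rw [Nat.frequently_atTop_iff_infinite] at hX
  have hex : ∀ n, K C (initSeg X n) ≤ (n + d : ℕ) →
      ∃ k τ, g k = some (τ, initSeg X n) ∧ τ.length ≤ n + d := by
    intro n hn
    obtain ⟨τ, hτ, hl⟩ := K_le_natCast.1 hn
    obtain ⟨k, hk⟩ := (hgC _ _).1 hτ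
    exact ⟨k, τ, hk, hl⟩
  -- distinct `n` have distinct segments of `X` as values, hence occur at distinct stages `k n`
  choose! k τ hk hl using hex
  refine Nat.frequently_atTop_iff_infinite.2
    (Set.infinite_of_injOn_mapsTo (f := k) (fun n hn n' hn' h => ?_) (fun n hn => ?_) hX)
  · have h1 := hk n hn
    rw [h, hk n' hn', Option.some_inj, Prod.mk.injEq] at h1
    rw [← length_initSeg X n, ← h1.2, length_initSeg]
  · refine mem_generated.2 ⟨initSeg X n, ?_, mem_cyl_initSeg X n⟩
    have h1 : (τ n).length ≤ (initSeg X n).length + d := by rw [length_initSeg]; exact hl n hn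
    simp [S, hk n hn, h1]

/-! ### From tests to machines -/

theorem initSeg_add (X : ℕ → Bool) (m n : ℕ) :
    initSeg X (m + n) = initSeg X m ++ initSeg (fun i => X (m + i)) n := by
  refine List.ext_getElem (by simp [initSeg]) fun i h1 h2 => ?_
  rw [List.getElem_append]
  split_ifs with h
  · simp [initSeg]
  · rw [length_initSeg] at h
    simp [initSeg, Nat.add_sub_cancel' (not_lt.1 h)]

/-- The list of the codewords `1ᵏ 0 w`, with `true` for `1` and `false` for `0`, for
all strings `w` of length `n`. -/
def codewords (k n : ℕ) : List (List Bool) :=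
  (strings n).map fun w => List.replicate k true ++ false :: w

theorem primrec_codewords : Primrec₂ codewords := by
  have rep : Primrec fun n : ℕ => List.replicate n true :=
    (Primrec.nat_rec₁ [] (Primrec.list_cons.comp (Primrec.const true) Primrec.snd).to₂).of_eq
      fun n => by
        induction n with
        | zero => rfl
        | succ n ih => simp_all [List.replicate_succ]
  exact Primrec.list_map (primrec_strings.comp Primrec.snd) (Primrec.list_append.comp
    (rep.comp (Primrec.fst.comp Primrec.fst))
    (Primrec.list_cons.comp (Primrec.const false) Primrec.snd)).to₂

theorem length_codewords (k n : ℕ) : (codewords k n).length = 2 ^ n := by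
  simp [codewords, length_strings]

theorem nodup_codewords (k n : ℕ) : (codewords k n).Nodup :=
  (nodup_strings n).map fun _ _ h => (List.cons.inj (List.append_cancel_left h)).2

theorem mem_codewords {k n : ℕ} {τ : List Bool} :
    τ ∈ codewords k n ↔
      ∃ w : List Bool, w.length = n ∧ List.replicate k true ++ false :: w = τ := by
  simp [codewords, mem_strings]

theorem idxOf_false_replicate (k : ℕ) (w : List Bool) :
    (List.replicate k true ++ false :: w).idxOf false = k := by
  rw [List.idxOf_append_of_notMem (by simp [List.mem_replicate])]
  simp

theorem length_of_mem_codewords {k n : ℕ} {τ : List Bool} (h : τ ∈ codewords k n) :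
    τ.length = k + 1 + n := by
  obtain ⟨w, hw, rfl⟩ := mem_codewords.1 h
  simp [hw]
  omega

theorem idxOf_false_of_mem_codewords {k n : ℕ} {τ : List Bool} (h : τ ∈ codewords k n) :
    τ.idxOf false = k := by
  obtain ⟨w, hw, rfl⟩ := mem_codewords.1 h
  exact idxOf_false_replicate k w

theorem prefixFree_codewords (ℓ : ℕ → ℕ) : PrefixFree {τ | ∃ k, τ ∈ codewords k (ℓ k)} := by
  rintro σ ⟨k, hσ⟩ τ ⟨k', hτ⟩ h
  have hk : k = k' := by
    rw [← idxOf_false_of_mem_codewords hτ]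
    obtain ⟨w, hw, rfl⟩ := mem_codewords.1 hσ
    obtain ⟨u, rfl⟩ := h
    rw [List.append_assoc, List.cons_append, idxOf_false_replicate]
  subst hk
  exact h.eq_of_length (by rw [length_of_mem_codewords hσ, length_of_mem_codewords hτ])

/-- The codewords generate every infinite bitstring other than `111…`. -/
theorem lebesgue_real_generated_codewords (ℓ : ℕ → ℕ) :
    lebesgue.real (generated {τ | ∃ k, τ ∈ codewords k (ℓ k)}) = 1 := by
  set G := generated {τ | ∃ k, τ ∈ codewords k (ℓ k)} with hG
  have hsub : ∀ n, Gᶜ ⊆ cyl (List.replicate n true) := by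
    intro n X hX
    refine mem_cyl.2 fun i _ => ?_
    rw [List.getElem_replicate]
    by_contra hi
    have hex : ∃ k, X k = false := ⟨i, by simpa using hi⟩
    classical
    let k := Nat.find hex
    refine hX (mem_generated.2 ⟨initSeg X (k + (ℓ k + 1)), ⟨k, mem_codewords.2
      ⟨initSeg (fun i => X (k + (1 + i))) (ℓ k), length_initSeg _ _, ?_⟩⟩, mem_cyl_initSeg _ _⟩)
    have h1 : initSeg X k = List.replicate k true := by
      rw [List.eq_replicate_iff]
      refine ⟨length_initSeg X k, fun b hb => ?_⟩
      obtain ⟨i, rfl⟩ := (List.mem_ofFn' _ _).1 hb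
      simpa using Nat.find_min hex i.2
    have h2 : initSeg (fun i => X (k + i)) 1 = [false] := by
      simpa [initSeg] using Nat.find_spec hex
    rw [initSeg_add, h1, add_comm (ℓ k), initSeg_add, h2, List.singleton_append]
  have h0 : lebesgue.real Gᶜ ≤ 0 := by
    refine ge_of_tendsto' (tendsto_pow_atTop_nhds_zero_of_lt_one (r := (1 / 2 : ℝ)) (by norm_num)
      (by norm_num)) fun n => (measureReal_mono (hsub n)).trans_eq ?_
    rw [lebesgue_real_cyl, List.length_replicate, one_div_pow]
  have h1 := probReal_compl_eq_one_sub (μ := lebesgue) (measurableSet_generated _ : MeasurableSet G)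
  have h2 : 0 ≤ lebesgue.real Gᶜ := measureReal_nonneg
  linarith

/-- The machine mapping the `i`-th codeword `1ᵏ 0 w` with `|w| = ℓ k` to the `i`-th entry of `T k`,
or to the empty string if there is no such entry. The number `k` is read off from the argument as
the position of its first `false`; the list access fails exactly off the codewords. -/
def tableMachine (ℓ : ℕ → ℕ) (T : ℕ → List (List Bool)) : List Bool →. List Bool := fun τ =>
  (((codewords (τ.idxOf false) (ℓ (τ.idxOf false)))[
      (codewords (τ.idxOf false) (ℓ (τ.idxOf false))).idxOf τ]?).map fun _ =>
    (T (τ.idxOf false)).getD ((codewords (τ.idxOf false) (ℓ (τ.idxOf false))).idxOf τ) [] :)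

theorem dom_tableMachine (ℓ : ℕ → ℕ) (T : ℕ → List (List Bool)) :
    (tableMachine ℓ T).Dom = {τ | ∃ k, τ ∈ codewords k (ℓ k)} := by
  ext τ
  have : τ ∈ (tableMachine ℓ T).Dom ↔
      τ ∈ codewords (τ.idxOf false) (ℓ (τ.idxOf false)) := by
    rw [← List.idxOf_lt_length_iff]
    simp only [tableMachine, PFun.mem_dom, Part.mem_coe, Option.mem_def, Option.map_eq_some_iff,
      List.getElem?_eq_some_iff]
    grind
  rw [this]
  refine ⟨fun h => ⟨_, h⟩, ?_⟩
  rintro ⟨k, hk⟩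
  rwa [idxOf_false_of_mem_codewords hk]

theorem partrec_tableMachine {ℓ : ℕ → ℕ} {T : ℕ → List (List Bool)} (hℓ : Computable ℓ)
    (hT : Computable T) : Partrec (tableMachine ℓ T) := by
  have k : Computable fun τ : List Bool => τ.idxOf false :=
    (Primrec.list_idxOf.comp (Primrec.const false) Primrec.id).to_comp
  have D := primrec_codewords.to_comp.comp k (hℓ.comp k)
  have i : Computable fun τ : List Bool =>
      (codewords (τ.idxOf false) (ℓ (τ.idxOf false))).idxOf τ :=
    (Primrec.list_idxOf.to_comp.comp Computable.id D).of_eq fun τ => by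
      congr 1
      exact lawful_beq_subsingleton _ _
  exact Computable.ofOption (Computable.option_map (Computable.list_getElem?.comp D i)
    (((Primrec.list_getD []).to_comp.comp (hT.comp k) i).comp Computable.fst).to₂)

theorem isComputableMeasureMachine_tableMachine {ℓ : ℕ → ℕ} {T : ℕ → List (List Bool)}
    (hℓ : Computable ℓ) (hT : Computable T) :
    IsComputableMeasureMachine (tableMachine ℓ T) := by
  refine ⟨partrec_tableMachine hℓ hT, ?_, ?_⟩
  · rw [dom_tableMachine]
    exact prefixFree_codewords ℓ
  · rw [dom_tableMachine, lebesgue_real_generated_codewords]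
    exact computableReal_one

theorem K_tableMachine_le {ℓ : ℕ → ℕ} {T : ℕ → List (List Bool)} {k : ℕ}
    (h : (T k).length ≤ 2 ^ ℓ k) {σ : List Bool} (hσ : σ ∈ T k) :
    K (tableMachine ℓ T) σ ≤ (k + 1 + ℓ k : ℕ) := by
  obtain ⟨i, hi, rfl⟩ := List.mem_iff_getElem.1 hσ
  have hi' : i < (codewords k (ℓ k)).length := by
    rw [length_codewords]
    omega
  have hmem : (codewords k (ℓ k))[i] ∈ codewords k (ℓ k) := List.getElem_mem hi'
  refine K_le_natCast.2 ⟨(codewords k (ℓ k))[i], ?_, (length_of_mem_codewords hmem).le⟩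
  simp only [tableMachine, idxOf_false_of_mem_codewords hmem,
    (nodup_codewords k (ℓ k)).idxOf_getElem i hi', Part.mem_coe, Option.mem_def,
    List.getElem?_eq_getElem hi', List.getD_eq_getElem _ _ hi, Option.map_some]

/-- The concatenation of `S a, …, S (a + n - 1)`. -/
def block (S : ℕ → List (List Bool)) (a n : ℕ) : List (List Bool) :=
  n.rec [] fun i l => l ++ S (a + i)

theorem mem_block {S : ℕ → List (List Bool)} {a n : ℕ} {σ : List Bool} :
    σ ∈ block S a n ↔ ∃ i < n, σ ∈ S (a + i) := by
  induction n with
  | zero => simp [block]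
  | succ n ih =>
    change σ ∈ block S a n ++ S (a + n) ↔ _
    rw [List.mem_append, ih, Nat.exists_lt_succ_right]

theorem computable₂_block {S : ℕ → List (List Bool)} (hS : Computable S) :
    Computable₂ (block S) :=
  Computable.nat_rec Computable.snd (Computable.const []) (Computable.list_append.comp
    (Computable.snd.comp Computable.snd)
    (hS.comp (Primrec.nat_add.to_comp.comp (Computable.fst.comp Computable.fst)
      (Computable.fst.comp Computable.snd)))).to₂

theorem generated_block (S : ℕ → List (List Bool)) (a n : ℕ) :
    generated {σ | σ ∈ block S a n} =
      ⋃ i ∈ Finset.range n, generated {σ | σ ∈ S (a + i)} := by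
  ext X
  simp only [mem_generated, Set.mem_ofPred_eq, mem_block, Set.mem_iUnion, Finset.mem_range]
  grind

/-- For every Schnorr test there is a computable measure machine that, for each `X` failing the
test, describes infinitely many initial segments of `X` by strings that are not longer. -/
theorem IsSchnorrTest.exists_machine {S : ℕ → List (List Bool)} (hS : IsSchnorrTest S) :
    ∃ C, IsComputableMeasureMachine C ∧ ∀ X : ℕ → Bool, Fails X S →
      ∃ᶠ n : ℕ in atTop, K C (initSeg X n) ≤ n := by
  obtain ⟨hS, r, hr, hsum⟩ := hS
  obtain ⟨N, hN, hNr⟩ := exists_computable_modulus (computableDyadicSeq_generated hS) hr hsum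
  let M : ℕ → ℕ := fun k => N (2 * k)
  let B : ℕ → List (List Bool) := fun k => block S (M k) (M (k + 1) - M k)
  let ℓ : ℕ → ℕ := fun k => (B k).flatten.length
  let T : ℕ → List (List Bool) := fun k => extensions (B k) (ℓ k + 2 * k)
  have dbl : Computable fun k : ℕ => 2 * k :=
    (Primrec.nat_mul.comp (Primrec.const 2) Primrec.id).to_comp
  have hM : Computable M := hN.comp dbl
  have hB : Computable B := (computable₂_block hS).comp hM
    (Primrec.nat_sub.to_comp.comp (hM.comp Computable.succ) hM)
  have hℓ : Computable ℓ :=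
    Primrec.list_length.to_comp.comp (Primrec.list_flatten.to_comp.comp hB)
  have hT : Computable T :=
    primrec_extensions.to_comp.comp hB (Primrec.nat_add.to_comp.comp hℓ dbl)
  have hlen : ∀ k, ∀ σ ∈ B k, σ.length ≤ ℓ k + 2 * k := fun k σ hσ =>
    (length_le_length_flatten hσ).trans (Nat.le_add_right _ _)
  have hcard : ∀ k, (T k).length ≤ 2 ^ ℓ k := by
    intro k
    have h1 : lebesgue.real (generated {σ | σ ∈ B k}) ≤ (1 / 2) ^ (2 * k) := by
      rw [generated_block]
      refine (measureReal_biUnion_finset_le _ _).trans ?_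
      have h2 := sum_le_hasSum (Finset.range (M k + (M (k + 1) - M k)))
        (fun m _ => measureReal_nonneg) hsum
      rw [Finset.sum_range_add] at h2
      have h3 := (hNr (2 * k)).2
      change r - ∑ m ∈ Finset.range (M k), _ < _ at h3
      linarith
    rw [lebesgue_real_generated (hlen k), one_div_pow,
      div_le_div_iff₀ (by positivity) (by positivity), one_mul, pow_add,
      mul_le_mul_iff_of_pos_right (by positivity)] at h1
    exact_mod_cast h1
  refine ⟨tableMachine ℓ T, isComputableMeasureMachine_tableMachine hℓ hT, fun X hX => ?_⟩
  refine frequently_atTop.2 fun n₀ => ?_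
  -- `n₀ + 1` rather than `n₀` ensures `1 ≤ k` below, so codewords are no longer than entries
  obtain ⟨m, hm, hXm⟩ := frequently_atTop.1 hX (M (n₀ + 1))
  have hex : ∃ j, m < M (n₀ + 1 + j + 1) :=
    ⟨m, lt_of_lt_of_le (by omega) (hNr _).1⟩
  classical
  -- `M` need not be monotone; the first `M (n₀ + 1 + j + 1)` exceeding `m` yields a block with `m`
  let j := Nat.find hex
  have hj : m < M (n₀ + 1 + j + 1) := Nat.find_spec hex
  have hj' : M (n₀ + 1 + j) ≤ m := by
    rcases h : j with _ | i
    · exact hm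
    · exact not_lt.1 (Nat.find_min hex (m := i) (show i < j by omega))
  set k := n₀ + 1 + j with hk
  have hXk : X ∈ generated {σ | σ ∈ B k} := by
    rw [generated_block]
    refine Set.mem_biUnion (x := m - M k) (Finset.mem_coe.2 (Finset.mem_range.2 (by omega))) ?_
    rwa [Nat.add_sub_cancel' hj']
  refine ⟨ℓ k + 2 * k, by omega, ?_⟩
  refine (K_tableMachine_le (hcard k) ((initSeg_mem_extensions (hlen k)).2 hXk)).trans ?_
  exact Nat.cast_le.2 (by omega)

end SchnorrK

theorem mainTheorem4 (X : ℕ → Bool) :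
    SchnorrK.SchnorrRandom X ↔
      ∀ C : List Bool →. List Bool, SchnorrK.IsComputableMeasureMachine C →
        ∀ d : ℕ, ∀ᶠ n : ℕ in Filter.atTop,
          ((n : ℕ∞) + (d : ℕ∞)) < SchnorrK.K C (SchnorrK.initSeg X n) := by
  constructor
  · intro hX C hC d
    obtain ⟨S, hS, hSX⟩ := hC.exists_isSchnorrTest d
    by_contra h
    refine hX S hS (hSX X ?_)
    simpa only [Filter.not_eventually, not_lt, Nat.cast_add] using h
  · intro h S hS hX
    obtain ⟨C, hC, hCX⟩ := hS.exists_machine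
    refine hCX X hX ((h C hC 0).mono fun n hn => ?_)
    simpa using hn
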